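/- Let $\mathcal H$ be a real Hilbert space with its Borel $\sigma$-algebra. Let $(\mathcal P_t)_{t\ge 0}$ be a Markov semigroup on $\mathcal H$ with transition probabilities $P_t(x,\cdot)$, so that $\mathcal P_t\varphi(x)=\int\varphi(y)\,P_t(x,dy)$. A semimetric on $\mathcal H$ is a symmetric, lower semicontinuous function $d:\mathcal H\times\mathcal H\to[0,\infty)$ with $d(x,y)=0\Leftrightarrow x=y$ (the triangle inequality is not required). For probability measures $\mu_1,\mu_2$ on $\mathcal H$ put $W_d(\mu_1,\mu_2)=\inf_\Gamma\int d(x,y)\,\Gamma(dx,dy)$, the infimum being over all couplings $\Gamma$ of $\mu_1$ and $\mu_2$, and for $\varphi:\mathcal H\to\mathbb R$ put $$\|\varphi\|_d=\sup_{x\neq y}\frac{|\varphi(x)-\varphi(y)|}{d(x,y)}\in[0,\infty].$$ Suppose that: 1. there is a continuous Lyapunov function $V:\mathcal H\to[0,\infty)$, that is, for some constants $C_V,\gamma,K_V>0$, $$\mathcal P_tV(x)\le C_Ve^{-\gamma t}V(x)+K_V\qquad\text{for all }x\in\mathcal H,\ t\ge 0;$$ 2. there are $T>0$ and a semimetric $d:\mathcal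 H\times\mathcal H\to[0,1]$ that is contracting for $\mathcal P_T$, that is, there is $\alpha<1$ with $W_d(P_T(x,\cdot),P_T(y,\cdot))\le\alpha\,d(x,y)$ whenever $d(x,y)<1$; 3. the level set $\{x: V(x)\le 4K_V\}$ is $d$-small for $\mathcal P_T$, that is, there is $\varepsilon\in(0,1]$ with $W_d(P_T(x,\cdot),P_T(y,\cdot))\le 1-\varepsilon$ for all $x,y$ in this set. Let $\tilde d(x,y)=\sqrt{d(x,y)\,(1+V(x)+V(y))}$. Then there exist $\rho\in[0,1)$ and $t_*>0$ such that, for every measurable $\varphi:\mathcal H\to\mathbb R$ with $\|\varphi\|_{\tilde d}<\infty$, the function $\varphi$ is integrable with respect to $P_{t_*}(x,\cdot)$ for every $x\in\mathcal H$ and, for every invariant probability measure $\mu_*$ of $(\mathcal P_t)_{t\ge 0}$, it is also integrable with respect to $\mu_*$ and, with $\langle\varphi,\mu_*\rangle=\int\varphi\,d\mu_*$, $$\|\mathcal P_{t_*}\varphi-\langle\varphi,\mu_*\rangle\|_{\tilde d}\le\rho\,\|\varphi-\langle\varphi,\mu_*\rangle\|_{\tilde d}.$$ -/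

import Mathlib

open MeasureTheory ProbabilityTheory
open scoped NNReal ENNReal

namespace HarrisGap

/-- A Markov semigroup, given by its transition probabilities `P t x = P_t(x, ·)`: Markov kernels
with `P_0(x, ·) = δ_x` that satisfy the Chapman-Kolmogorov equations. -/
structure IsMarkovSemigroup {H : Type*} [MeasurableSpace H] (P : ℝ≥0 → Kernel H H) : Prop where
  markov : ∀ t, IsMarkovKernel (P t)
  zero : P 0 = Kernel.id
  add : ∀ s t, P (s + t) = P t ∘ₖ P s

/-- The action of a kernel on observables, `(P φ)(x) = ∫ φ(y) P(x, dy)`. -/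
noncomputable def act {H : Type*} [MeasurableSpace H] (P : Kernel H H) (φ : H → ℝ) : H → ℝ :=
  fun x => ∫ y, φ y ∂(P x)

/-- `μ` is an invariant probability measure of the semigroup: `P_t^* μ = μ` for all `t ≥ 0`. -/
structure IsInvariantMeasure {H : Type*} [MeasurableSpace H] (P : ℝ≥0 → Kernel H H)
    (μ : Measure H) : Prop where
  prob : IsProbabilityMeasure μ
  invariant : ∀ t, Kernel.Invariant (P t) μ

/-- A semimetric (distance-like function); no triangle inequality is required. -/
structure IsSemimetric {H : Type*} [TopologicalSpace H] (d : H → H → ℝ≥0) : Prop where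
  symm : ∀ x y, d x y = d y x
  lsc : LowerSemicontinuous (fun p : H × H => d p.1 p.2)
  eq_zero_iff : ∀ x y, d x y = 0 ↔ x = y

/-- `Γ` is a coupling of `μ₁` and `μ₂`: a measure on the product with these marginals. -/
def IsCoupling {H : Type*} [MeasurableSpace H] (Γ : Measure (H × H)) (μ₁ μ₂ : Measure H) : Prop :=
  Γ.map Prod.fst = μ₁ ∧ Γ.map Prod.snd = μ₂

/-- The Wasserstein semimetric `W_d(μ₁, μ₂)`, with values in `[0, ∞]`. -/
noncomputable def wasserstein {H : Type*} [MeasurableSpace H] (d : H → H → ℝ≥0)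
    (μ₁ μ₂ : Measure H) : ℝ≥0∞ :=
  ⨅ (Γ : Measure (H × H)) (_ : IsCoupling Γ μ₁ μ₂), ∫⁻ p, (d p.1 p.2 : ℝ≥0∞) ∂Γ

/-- The Lipschitz seminorm `‖φ‖_d = sup_{x ≠ y} |φ(x) - φ(y)| / d(x, y)`, with values in
`[0, ∞]`. -/
noncomputable def lipSeminorm {H : Type*} (d : H → H → ℝ≥0) (φ : H → ℝ) : ℝ≥0∞ :=
  ⨆ (x : H) (y : H) (_ : x ≠ y), ENNReal.ofReal |φ x - φ y| / (d x y : ℝ≥0∞)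

/-- `V : H → ℝ₊` is a Lyapunov function with constants `C, γ, K > 0`:
`P_t V(x) ≤ C e^{-γ t} V(x) + K` for all `x` and all `t ≥ 0`. -/
structure IsLyapunov {H : Type*} [MeasurableSpace H] (P : ℝ≥0 → Kernel H H) (V : H → ℝ≥0)
    (C γ K : ℝ) : Prop where
  measurable : Measurable V
  C_pos : 0 < C
  γ_pos : 0 < γ
  K_pos : 0 < K
  bound : ∀ (t : ℝ≥0) (x : H), ∫⁻ y, (V y : ℝ≥0∞) ∂(P t x) ≤
    ENNReal.ofReal (C * Real.exp (-γ * (t : ℝ)) * (V x : ℝ) + K)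

/-- The set `S` is `d`-small for the Markov kernel `P`. -/
def IsSmall {H : Type*} [MeasurableSpace H] (d : H → H → ℝ≥0) (P : Kernel H H)
    (S : Set H) : Prop :=
  ∃ ε : ℝ, 0 < ε ∧ ε ≤ 1 ∧ ∀ x ∈ S, ∀ y ∈ S,
    wasserstein d (P x) (P y) ≤ ENNReal.ofReal (1 - ε)

/-- The semimetric `d` is contracting for the Markov kernel `P`. -/
def IsContracting {H : Type*} [MeasurableSpace H] (d : H → H → ℝ≥0) (P : Kernel H H) : Prop :=
  ∃ α : ℝ≥0, α < 1 ∧ ∀ x y, d x y < 1 →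
    wasserstein d (P x) (P y) ≤ (α : ℝ≥0∞) * (d x y : ℝ≥0∞)

/-- The weighted semimetric `d̃(x, y) = √(d(x, y) (1 + V(x) + V(y)))`. -/
noncomputable def weighted {H : Type*} (d : H → H → ℝ≥0) (V : H → ℝ≥0) : H → H → ℝ≥0 :=
  fun x y => NNReal.sqrt (d x y * (1 + V x + V y))

end HarrisGap

/-! This is a weak Harris argument run on observables. For a coupling of `P_T(x,·)` and `P_T(y,·)`,
Cauchy-Schwarz splits the increment of `φ` into a transport cost and a mean weight, so
`OscBound.sq_integral_sub_le` bounds its square by `M W_d (∫w dμ + ∫w dν)`. Contraction and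
smallness are known at time `T` only, while `C e^{-γT}` may exceed 1. So `n` steps that merely do
not expand `W_d` carry the exact weight along (`OscBound.act_nsmul`), and one step prepended to them
supplies the gain in `W_d`; the Lyapunov bound is used once, at the total time. With weight `1 +
β(V(x) + V(y))` there are three cases: `d < 1` gains by contraction; `d = 1` with `V(x) + V(y) < 4K`
gains by smallness; otherwise the weight itself shrinks (`exists_oscBound_contraction`). Replacing
`β` by 1 costs a factor `β⁻¹`, absorbed by iteration. Constants do not affect the seminorm, so the
invariant measure matters only for integrability. -/

namespace HarrisGap

/-! ### Couplings and Cauchy-Schwarz. -/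

section Coupling

variable {H : Type*} [MeasurableSpace H]

lemma isCoupling_prod (μ ν : Measure H) [IsProbabilityMeasure μ] [IsProbabilityMeasure ν] :
    IsCoupling (μ.prod ν) μ ν :=
  ⟨by rw [Measure.map_fst_prod, measure_univ, one_smul],
    by rw [Measure.map_snd_prod, measure_univ, one_smul]⟩

lemma wasserstein_le_one (d : H → H → ℝ≥0) (hd : ∀ x y, d x y ≤ 1) (μ ν : Measure H)
    [IsProbabilityMeasure μ] [IsProbabilityMeasure ν] : wasserstein d μ ν ≤ 1 := by
  refine (iInf₂_le (μ.prod ν) (isCoupling_prod μ ν)).trans ?_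
  calc ∫⁻ p, (d p.1 p.2 : ℝ≥0∞) ∂(μ.prod ν) ≤ ∫⁻ _, 1 ∂(μ.prod ν) :=
        lintegral_mono fun p => ENNReal.coe_le_one_iff.2 (hd p.1 p.2)
    _ = 1 := by simp

lemma IsCoupling.lintegral_add {μ ν : Measure H} {Γ : Measure (H × H)} (hΓ : IsCoupling Γ μ ν)
    {w : H → ℝ≥0∞} (hw : Measurable w) :
    ∫⁻ p, (w p.1 + w p.2) ∂Γ = ∫⁻ x, w x ∂μ + ∫⁻ x, w x ∂ν := by
  rw [← hΓ.1, ← hΓ.2, lintegral_map hw measurable_fst, lintegral_map hw measurable_snd]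
  exact lintegral_add_left (hw.comp measurable_fst) _

lemma IsCoupling.integral_sub {μ ν : Measure H} {Γ : Measure (H × H)} (hΓ : IsCoupling Γ μ ν)
    {φ : H → ℝ} (hφ : Measurable φ) (hμ : Integrable φ μ) (hν : Integrable φ ν) :
    ∫ p, (φ p.1 - φ p.2) ∂Γ = ∫ x, φ x ∂μ - ∫ x, φ x ∂ν := by
  obtain ⟨rfl, rfl⟩ := hΓ
  rw [integral_map measurable_fst.aemeasurable hφ.aestronglyMeasurable,
    integral_map measurable_snd.aemeasurable hφ.aestronglyMeasurable]
  exact MeasureTheory.integral_sub (hμ.comp_measurable measurable_fst)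
    (hν.comp_measurable measurable_snd)

/-- The square of the oscillation of `φ` is at most `M d(u, v) (w(u) + w(v))`. -/
def OscBound (d : H → H → ℝ≥0) (w : H → ℝ≥0∞) (M : ℝ≥0) (φ : H → ℝ) : Prop :=
  ∀ u v, ‖φ u - φ v‖ₑ ^ 2 ≤ M * (d u v * (w u + w v))

variable {d : H → H → ℝ≥0} {w : H → ℝ≥0∞} {M : ℝ≥0} {φ : H → ℝ}

/-- Since `a ≤ 1 + a²` and `d ≤ 1`, `φ` grows at most linearly in `w`. -/
lemma OscBound.integrable (h : OscBound d w M φ) (hd : ∀ x y, d x y ≤ 1)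
    (hφ : Measurable φ) (hfin : ∀ x, w x ≠ ∞) {μ : Measure H} [IsProbabilityMeasure μ]
    (hμ : ∫⁻ x, w x ∂μ ≠ ∞) : Integrable φ μ := by
  obtain ⟨x₀⟩ : Nonempty H := nonempty_of_isProbabilityMeasure μ
  have hsub : Integrable (fun u => φ u - φ x₀) μ := by
    refine ⟨(hφ.sub_const _).aestronglyMeasurable, ?_⟩
    calc ∫⁻ u, ‖φ u - φ x₀‖ₑ ∂μ ≤ ∫⁻ u, ((1 + M * w x₀) + M * w u) ∂μ := by
          refine lintegral_mono fun u => ?_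
          have h1 : ‖φ u - φ x₀‖ₑ ≤ 1 + ‖φ u - φ x₀‖ₑ ^ 2 := by
            rcases le_total ‖φ u - φ x₀‖ₑ 1 with h | h
            · exact h.trans le_self_add
            · exact (le_self_pow₀ h two_ne_zero).trans le_add_self
          refine h1.trans ?_
          rw [add_assoc]
          gcongr
          refine (h u x₀).trans ?_
          rw [← mul_add, add_comm (w x₀)]
          gcongr
          exact mul_le_of_le_one_left' (by exact_mod_cast hd u x₀)
      _ = (1 + M * w x₀) + M * ∫⁻ u, w u ∂μ := by
          rw [lintegral_add_left measurable_const, lintegral_const_mul' _ _ ENNReal.coe_ne_top]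
          simp
      _ < ∞ := by
          simp only [ENNReal.add_lt_top, ENNReal.one_lt_top, true_and]
          exact ⟨ENNReal.mul_lt_top ENNReal.coe_lt_top (hfin _).lt_top,
            ENNReal.mul_lt_top ENNReal.coe_lt_top hμ.lt_top⟩
  refine (hsub.add (integrable_const (φ x₀))).congr (Filter.Eventually.of_forall fun u => ?_)
  simp

/-- Cauchy-Schwarz against a coupling. Only the measurability of `φ` and `w` is used: `d` need not
be measurable for the product σ-algebra. -/
lemma OscBound.sq_integral_sub_le (h : OscBound d w M φ) (hφ : Measurable φ) (hw : Measurable w)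
    (hfin : ∀ x, w x ≠ ∞) (hpos : ∀ x, w x ≠ 0) {μ ν : Measure H}
    [IsProbabilityMeasure μ] [IsProbabilityMeasure ν]
    (hμ : Integrable φ μ) (hν : Integrable φ ν)
    (hwμ : ∫⁻ x, w x ∂μ ≠ ∞) (hwν : ∫⁻ x, w x ∂ν ≠ ∞) :
    ‖∫ x, φ x ∂μ - ∫ x, φ x ∂ν‖ₑ ^ 2 ≤
      M * (wasserstein d μ ν * (∫⁻ x, w x ∂μ + ∫⁻ x, w x ∂ν)) := by
  set c := ∫⁻ x, w x ∂μ + ∫⁻ x, w x ∂ν with hc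
  have hc_top : c ≠ ∞ := ENNReal.add_ne_top.2 ⟨hwμ, hwν⟩
  have hc_zero : c ≠ 0 := by
    intro h0
    have h1 : ∫⁻ x, w x ∂μ = 0 := (add_eq_zero.1 h0).1
    rw [lintegral_eq_zero_iff hw] at h1
    obtain ⟨x, hx⟩ := h1.exists
    exact hpos x hx
  have key : ∀ Γ : Measure (H × H), IsCoupling Γ μ ν →
      ‖∫ x, φ x ∂μ - ∫ x, φ x ∂ν‖ₑ ^ 2 ≤ (M * ∫⁻ p, (d p.1 p.2 : ℝ≥0∞) ∂Γ) * c := by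
    intro Γ hΓ
    have hosc : Measurable fun p : H × H => ‖φ p.1 - φ p.2‖ₑ :=
      ((hφ.comp measurable_fst).sub (hφ.comp measurable_snd)).enorm
    have hsum : Measurable fun p : H × H => w p.1 + w p.2 :=
      (hw.comp measurable_fst).add (hw.comp measurable_snd)
    have hsum_top : ∀ p : H × H, w p.1 + w p.2 ≠ ∞ := fun p =>
      ENNReal.add_ne_top.2 ⟨hfin _, hfin _⟩
    have hsum_zero : ∀ p : H × H, w p.1 + w p.2 ≠ 0 := fun p h0 => hpos _ (add_eq_zero.1 h0).1
    -- A measurable stand-in for `M d`: it lies below `M d` pointwise, and Hölder is applied to it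
    -- instead.
    let g : H × H → ℝ≥0∞ := fun p => ‖φ p.1 - φ p.2‖ₑ ^ 2 / (w p.1 + w p.2)
    have hg : Measurable g := (hosc.pow_const 2).div hsum
    have hfactor : ∀ p, ‖φ p.1 - φ p.2‖ₑ = g p ^ (1 / 2 : ℝ) * (w p.1 + w p.2) ^ (1 / 2 : ℝ) := by
      intro p
      rw [← ENNReal.mul_rpow_of_nonneg _ _ (by norm_num),
        ENNReal.div_mul_cancel (hsum_zero p) (hsum_top p), ← ENNReal.rpow_natCast,
        ← ENNReal.rpow_mul]
      norm_num
    have hgd : ∫⁻ p, g p ∂Γ ≤ M * ∫⁻ p, (d p.1 p.2 : ℝ≥0∞) ∂Γ := by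
      rw [← lintegral_const_mul' _ _ ENNReal.coe_ne_top]
      refine lintegral_mono fun p => ?_
      refine (ENNReal.div_le_iff (hsum_zero p) (hsum_top p)).2 ?_
      rw [mul_assoc]
      exact h p.1 p.2
    have hCS : ‖∫ x, φ x ∂μ - ∫ x, φ x ∂ν‖ₑ ≤
        (∫⁻ p, g p ∂Γ) ^ (1 / 2 : ℝ) * c ^ (1 / 2 : ℝ) := by
      rw [← hΓ.integral_sub hφ hμ hν, hc, ← hΓ.lintegral_add hw]
      refine (enorm_integral_le_lintegral_enorm _).trans ?_
      simp_rw [hfactor]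
      exact ENNReal.lintegral_mul_norm_pow_le hg.aemeasurable hsum.aemeasurable
        (by norm_num) (by norm_num) (by norm_num)
    calc ‖∫ x, φ x ∂μ - ∫ x, φ x ∂ν‖ₑ ^ 2
        ≤ ((∫⁻ p, g p ∂Γ) ^ (1 / 2 : ℝ) * c ^ (1 / 2 : ℝ)) ^ 2 := by gcongr
      _ = (∫⁻ p, g p ∂Γ) * c := by
          rw [← ENNReal.mul_rpow_of_nonneg _ _ (by norm_num), ← ENNReal.rpow_natCast,
            ← ENNReal.rpow_mul]
          norm_num
      _ ≤ _ := by gcongr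
  -- Passing to the infimum over couplings divides by `M c`, hence `M = 0` apart.
  rcases eq_or_ne M 0 with rfl | hM
  · simpa using key _ (isCoupling_prod μ ν)
  · have hM0 : (M : ℝ≥0∞) ≠ 0 := by exact_mod_cast hM
    have hMc : (M : ℝ≥0∞) * c ≠ 0 := mul_ne_zero hM0 hc_zero
    have hMc' : (M : ℝ≥0∞) * c ≠ ∞ := ENNReal.mul_ne_top ENNReal.coe_ne_top hc_top
    have hrew : (M : ℝ≥0∞) * (wasserstein d μ ν * c) = wasserstein d μ ν * (M * c) := by ring
    rw [hrew, ← ENNReal.div_le_iff hMc hMc']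
    refine le_iInf₂ fun Γ hΓ => (ENNReal.div_le_iff hMc hMc').2 ?_
    refine (key Γ hΓ).trans (le_of_eq ?_)
    ring

end Coupling

/-! ### The weight with parameter `β`. -/

section Weight

variable {H : Type*} {V : H → ℝ≥0}

/-- Half of the weight `1 + β V(x) + β V(y)`. -/
noncomputable def halfWeight (V : H → ℝ≥0) (β : ℝ≥0) (x : H) : ℝ≥0∞ := 2⁻¹ + β * V x

lemma halfWeight_ne_top (β : ℝ≥0) (x : H) : halfWeight V β x ≠ ∞ := by
  simp [halfWeight, ENNReal.mul_eq_top]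

lemma halfWeight_add (β : ℝ≥0) (x y : H) :
    halfWeight V β x + halfWeight V β y = ((1 + β * (V x + V y) : ℝ≥0) : ℝ≥0∞) := by
  push_cast
  rw [halfWeight, halfWeight, ← ENNReal.inv_two_add_inv_two]
  ring

end Weight

/-! ### Lyapunov estimates and contraction of the oscillation bound. -/

section Semigroup

variable {H : Type*} [MeasurableSpace H] {P : ℝ≥0 → Kernel H H}

lemma measurable_act (Q : Kernel H H) [IsMarkovKernel Q] {φ : H → ℝ} (hφ : Measurable φ) :
    Measurable (act Q φ) :=
  (hφ.stronglyMeasurable.integral_kernel (κ := Q)).measurable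

lemma IsMarkovSemigroup.act_add (hP : IsMarkovSemigroup P) {φ : H → ℝ} (s t : ℝ≥0) {x : H}
    (hφ : Integrable φ (P (s + t) x)) : act (P (s + t)) φ x = act (P s) (act (P t) φ) x := by
  unfold act
  rw [hP.add] at hφ ⊢
  exact Kernel.integral_comp hφ

variable {d : H → H → ℝ≥0} {V : H → ℝ≥0} {C γ K : ℝ}

lemma IsLyapunov.lintegral_ne_top (hV : IsLyapunov P V C γ K) (t : ℝ≥0) (x : H) :
    ∫⁻ y, (V y : ℝ≥0∞) ∂(P t x) ≠ ∞ :=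
  ((hV.bound t x).trans_lt ENNReal.ofReal_lt_top).ne

lemma measurable_halfWeight (hV : Measurable V) (β : ℝ≥0) : Measurable (halfWeight V β) :=
  (hV.coe_nnreal_ennreal.const_mul _).const_add _

lemma lintegral_halfWeight (β : ℝ≥0) (μ : Measure H) [IsProbabilityMeasure μ] :
    ∫⁻ y, halfWeight V β y ∂μ = 2⁻¹ + β * ∫⁻ y, (V y : ℝ≥0∞) ∂μ := by
  unfold halfWeight
  rw [lintegral_add_left measurable_const, lintegral_const_mul' _ _ ENNReal.coe_ne_top]
  simp

lemma lintegral_halfWeight_ne_top (hP : IsMarkovSemigroup P) (hV : IsLyapunov P V C γ K)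
    (β t : ℝ≥0) (x : H) : ∫⁻ y, halfWeight V β y ∂(P t x) ≠ ∞ := by
  have := hP.markov t
  rw [lintegral_halfWeight]
  exact ENNReal.add_ne_top.2 ⟨by simp,
    ENNReal.mul_ne_top ENNReal.coe_ne_top (hV.lintegral_ne_top t x)⟩

lemma lintegral_halfWeight_add_le (hP : IsMarkovSemigroup P) (hV : IsLyapunov P V C γ K)
    (β t : ℝ≥0) {a : ℝ} (ha : C * Real.exp (-γ * t) ≤ a) (x y : H) :
    ∫⁻ z, halfWeight V β z ∂(P t x) + ∫⁻ z, halfWeight V β z ∂(P t y) ≤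
      ENNReal.ofReal (1 + 2 * (β * K) + a * (β * (V x + V y))) := by
  have := hP.markov t
  have ha0 : 0 ≤ a := (mul_pos hV.C_pos (Real.exp_pos _)).le.trans ha
  have hK := hV.K_pos.le
  have hb : ∀ x, ∫⁻ y, (V y : ℝ≥0∞) ∂(P t x) ≤ ENNReal.ofReal (a * V x + K) := fun x =>
    (hV.bound t x).trans (ENNReal.ofReal_le_ofReal (by gcongr))
  have hx : ∀ x, ∫⁻ z, halfWeight V β z ∂(P t x) ≤
      ENNReal.ofReal (2⁻¹ + β * (a * V x + K)) := by
    intro x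
    rw [lintegral_halfWeight, ENNReal.ofReal_add (by positivity) (by positivity),
      ENNReal.ofReal_mul β.coe_nonneg, ENNReal.ofReal_inv_of_pos two_pos]
    simp only [ENNReal.ofReal_ofNat, ENNReal.ofReal_coe_nnreal]
    gcongr
    exact hb x
  refine (add_le_add (hx x) (hx y)).trans ?_
  rw [← ENNReal.ofReal_add (by positivity) (by positivity)]
  refine ENNReal.ofReal_le_ofReal (le_of_eq ?_)
  ring

lemma IsContracting.wasserstein_le {Q : Kernel H H} [IsMarkovKernel Q]
    (hd : ∀ x y, d x y ≤ 1) (hQ : IsContracting d Q) (x y : H) :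
    wasserstein d (Q x) (Q y) ≤ d x y := by
  obtain ⟨α, hα, h⟩ := hQ
  rcases (hd x y).lt_or_eq with hlt | heq
  · exact (h x y hlt).trans (mul_le_of_le_one_left' (by exact_mod_cast hα.le))
  · rw [heq]
    exact wasserstein_le_one d hd _ _

/-- Prepending a step of the kernel `P T` to `P t` transports the oscillation bound through the
Wasserstein semimetric of that step only. -/
lemma OscBound.sq_act_add_sub_le (hP : IsMarkovSemigroup P) (hV : IsLyapunov P V C γ K)
    (hd : ∀ x y, d x y ≤ 1) {β M T t : ℝ≥0} {φ : H → ℝ} (hφ : Measurable φ)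
    (h : OscBound d (halfWeight V β) M φ)
    (ht : OscBound d (fun x => ∫⁻ y, halfWeight V β y ∂(P t x)) M (act (P t) φ)) (x y : H) :
    ‖act (P (T + t)) φ x - act (P (T + t)) φ y‖ₑ ^ 2 ≤
      M * (wasserstein d (P T x) (P T y) *
        (∫⁻ z, halfWeight V β z ∂(P (T + t) x) + ∫⁻ z, halfWeight V β z ∂(P (T + t) y))) := by
  have := hP.markov
  have hw := measurable_halfWeight hV.measurable β
  have hint : ∀ s x, Integrable φ (P s x) := fun s x =>
    h.integrable hd hφ (halfWeight_ne_top β) (lintegral_halfWeight_ne_top hP hV β s x)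
  have hcomp : ∀ x, ∫⁻ z, halfWeight V β z ∂(P (T + t) x) =
      ∫⁻ y, ∫⁻ z, halfWeight V β z ∂(P t y) ∂(P T x) := fun x => by
    rw [hP.add, Kernel.lintegral_comp _ _ _ hw]
  have hne : ∀ x, ∫⁻ y, ∫⁻ z, halfWeight V β z ∂(P t y) ∂(P T x) ≠ ∞ := fun x => by
    rw [← hcomp]
    exact lintegral_halfWeight_ne_top hP hV β _ x
  have hfin : ∀ x, ∫⁻ z, halfWeight V β z ∂(P t x) ≠ ∞ :=
    lintegral_halfWeight_ne_top hP hV β t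
  have hact := measurable_act (P t) hφ
  rw [hcomp, hcomp, hP.act_add T t (hint _ _), hP.act_add T t (hint _ _)]
  refine ht.sq_integral_sub_le hact (hw.lintegral_kernel) hfin ?_
    (ht.integrable hd hact hfin (hne x)) (ht.integrable hd hact hfin (hne y)) (hne x) (hne y)
  intro z
  rw [lintegral_halfWeight]
  simp

/-- Each step has `W_d ≤ d`, so `M` is unchanged; keeping the weight exact prevents `C` from
compounding. -/
lemma OscBound.act_nsmul (hP : IsMarkovSemigroup P) (hV : IsLyapunov P V C γ K)
    (hd : ∀ x y, d x y ≤ 1) {T : ℝ≥0} (hT : IsContracting d (P T)) {β M : ℝ≥0} {φ : H → ℝ}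
    (hφ : Measurable φ) (h : OscBound d (halfWeight V β) M φ) (n : ℕ) :
    OscBound d (fun x => ∫⁻ y, halfWeight V β y ∂(P (n • T) x)) M (act (P (n • T)) φ) := by
  induction n with
  | zero =>
    have hw := measurable_halfWeight hV.measurable β
    intro x y
    simpa [act, hP.zero, Kernel.id_apply, lintegral_dirac' _ hw,
      integral_dirac' _ _ hφ.stronglyMeasurable] using h x y
  | succ n ih =>
    have := hP.markov T
    intro x y
    rw [succ_nsmul']
    refine (h.sq_act_add_sub_le hP hV hd hφ ih x y).trans ?_
    gcongr
    exact hT.wasserstein_le hd x y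

/-- The case analysis behind the weak Harris theorem, in numbers: `b = βK` and `s = β(V(x)+V(y))`,
while `c` bounds the Wasserstein semimetric after one step. -/
lemma contraction_of_cases {α ρ b s c δ : ℝ} (hb : 0 < b) (hs : 0 ≤ s) (hα : 0 ≤ α)
    (hρ : α * (1 + 2 * b) ≤ ρ) (hρ' : 1 + 3 * b ≤ ρ * (1 + 4 * b)) (hδ : 0 ≤ δ)
    (h : c ≤ α * δ ∨ (δ = 1 ∧ c ≤ 1 ∧ 4 * b ≤ s)) :
    c * (1 + 2 * b + 1 / 4 * s) ≤ ρ * (δ * (1 + s)) := by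
  rcases h with h | ⟨rfl, h, hbs⟩
  · calc c * (1 + 2 * b + 1 / 4 * s) ≤ (α * δ) * ((1 + 2 * b) * (1 + s)) := by
          gcongr
          -- The remaining claim is `1 + 2b + s/4 ≤ (1 + 2b)(1 + s)`.
          nlinarith [mul_nonneg hb.le hs]
      _ = (α * (1 + 2 * b)) * (δ * (1 + s)) := by ring
      _ ≤ _ := by gcongr
  · have h1 : c * (1 + 2 * b + 1 / 4 * s) ≤ 1 * (1 + 2 * b + 1 / 4 * s) := by gcongr
    -- With slope `ρ ≥ 1/4` on the right, the worst case is `s = 4b`, which is the hypothesis `hρ'`.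
    have h2 : (1 / 4 : ℝ) ≤ ρ := by
      by_contra! hlt
      nlinarith
    nlinarith

/-- For small `β` and a large multiple of `T`, the semigroup contracts the oscillation bound with
weight `1 + β V(x) + β V(y)`. -/
lemma exists_oscBound_contraction (hP : IsMarkovSemigroup P) (hV : IsLyapunov P V C γ K)
    (hd : ∀ x y, d x y ≤ 1) {T : ℝ≥0} (hT : 0 < T) (hcontr : IsContracting d (P T))
    (hsmall : IsSmall d (P T) {x : H | (V x : ℝ) ≤ 4 * K}) :
    ∃ β ρ t : ℝ≥0, 0 < β ∧ β ≤ 1 ∧ ρ < 1 ∧ 0 < t ∧ ∀ (φ : H → ℝ) (M : ℝ≥0), Measurable φ →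
      OscBound d (halfWeight V β) M φ → OscBound d (halfWeight V β) (ρ * M) (act (P t) φ) := by
  have := hP.markov
  have hK := hV.K_pos
  -- The factor `1/4` turns `1 + 2b + s/4` into `1 + 3b` at the threshold `s = 4b`, below `1 + 4b`.
  obtain ⟨n, hn⟩ : ∃ n : ℕ, C * Real.exp (-γ * ((T + n • T : ℝ≥0) : ℝ)) ≤ 1 / 4 := by
    have hlim : Filter.Tendsto (fun n : ℕ => C * Real.exp (-γ * ((T + n • T : ℝ≥0) : ℝ)))
        Filter.atTop (nhds (C * 0)) := by
      refine (Real.tendsto_exp_atBot.comp ?_).const_mul C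
      have hlin : Filter.Tendsto (fun n : ℕ => (n : ℝ) * (-γ * T) + (-γ * T))
          Filter.atTop Filter.atBot :=
        Filter.tendsto_atBot_add_const_right _ _
          (tendsto_natCast_atTop_atTop.atTop_mul_const_of_neg
            (mul_neg_of_neg_of_pos (neg_lt_zero.2 hV.γ_pos) (by exact_mod_cast hT)))
      refine hlin.congr fun n => ?_
      push_cast [nsmul_eq_mul]
      ring
    rw [mul_zero] at hlim
    exact (hlim.eventually_le_const (by norm_num : (0 : ℝ) < 1 / 4)).exists
  have hcontr' := hcontr
  obtain ⟨α, hα, hα'⟩ := hcontr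
  obtain ⟨ε, hε, hε1, hε'⟩ := hsmall
  set κ : ℝ := max α (1 - ε)
  have hκ0 : 0 ≤ κ := le_max_of_le_left α.coe_nonneg
  have hκ1 : κ < 1 := max_lt (by exact_mod_cast hα) (by linarith)
  -- Here `b = βK`: the first bound gives `κ(1 + 2b) < 1`, the second `β ≤ 1`.
  set b : ℝ := min ((1 - κ) / 4) K
  have hb : 0 < b := lt_min (by linarith) hK
  have hbκ : b ≤ (1 - κ) / 4 := min_le_left _ _
  set ρ : ℝ := max (κ * (1 + 2 * b)) ((1 + 3 * b) / (1 + 4 * b))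
  have hρ0 : 0 ≤ ρ := le_max_of_le_left (by positivity)
  have hρ1 : ρ < 1 := by
    refine max_lt (by nlinarith) ?_
    rw [div_lt_one (by positivity)]
    linarith
  have hρ2 : 1 + 3 * b ≤ ρ * (1 + 4 * b) := by
    rw [← div_le_iff₀ (by positivity)]
    exact le_max_right _ _
  have hβ : 0 < b / K := div_pos hb hK
  have hβ1 : b / K ≤ 1 := (div_le_one hK).2 (min_le_right _ _)
  refine ⟨(b / K).toNNReal, ρ.toNNReal, T + n • T, Real.toNNReal_pos.2 hβ,
    Real.toNNReal_le_one.2 hβ1, Real.toNNReal_lt_one.2 hρ1, by positivity, ?_⟩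
  intro φ M hφ h x y
  set β : ℝ≥0 := (b / K).toNNReal with hβdef
  have hβK : (β : ℝ) * K = b := by
    rw [hβdef, Real.coe_toNNReal _ hβ.le, div_mul_cancel₀ b hK.ne']
  obtain ⟨c, hc0, hWc, hc⟩ : ∃ c : ℝ, 0 ≤ c ∧
      wasserstein d (P T x) (P T y) ≤ ENNReal.ofReal c ∧
      (c ≤ κ * d x y ∨ ((d x y : ℝ) = 1 ∧ c ≤ 1 ∧ 4 * b ≤ β * (V x + V y))) := by
    rcases (hd x y).lt_or_eq with hlt | heq
    · refine ⟨α * d x y, by positivity, ?_, Or.inl ?_⟩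
      · rw [ENNReal.ofReal_mul α.coe_nonneg]
        simpa using hα' x y hlt
      · gcongr
        exact le_max_left _ _
    · by_cases hVxy : (4 : ℝ) * K ≤ V x + V y
      · refine ⟨1, zero_le_one, ?_, Or.inr ⟨by exact_mod_cast heq, le_rfl, ?_⟩⟩
        · simpa using wasserstein_le_one d hd _ _
        · rw [← hβK]
          nlinarith [mul_le_mul_of_nonneg_left hVxy β.coe_nonneg]
      · push Not at hVxy
        have hx := (V x).coe_nonneg
        have hy := (V y).coe_nonneg
        refine ⟨1 - ε, by linarith, hε' x ?_ y ?_, Or.inl ?_⟩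
        · exact (by linarith : (V x : ℝ) ≤ 4 * K)
        · exact (by linarith : (V y : ℝ) ≤ 4 * K)
        · rw [heq, NNReal.coe_one, mul_one]
          exact le_max_right _ _
  have hfinal := contraction_of_cases (s := β * (V x + V y)) hb (by positivity) hκ0
    (le_max_left _ _) hρ2 (d x y).coe_nonneg hc
  -- Only the first step enters `W_d`; the weight sees the full time `T + n • T`.
  refine (h.sq_act_add_sub_le hP hV hd hφ (h.act_nsmul hP hV hd hcontr' hφ n) x y).trans ?_
  rw [ENNReal.coe_mul, mul_comm _ (M : ℝ≥0∞), mul_assoc, halfWeight_add]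
  refine mul_le_mul' le_rfl ?_
  calc _ ≤ ENNReal.ofReal c * ENNReal.ofReal (1 + 2 * (β * K) + 1 / 4 * (β * (V x + V y))) := by
        gcongr
        exact lintegral_halfWeight_add_le hP hV β _ hn x y
    _ ≤ ENNReal.ofReal (ρ * (d x y * (1 + β * (V x + V y)))) := by
        rw [← ENNReal.ofReal_mul hc0, hβK]
        exact ENNReal.ofReal_le_ofReal hfinal
    _ = _ := by
        rw [ENNReal.ofReal_mul hρ0, ENNReal.ofReal_mul (d x y).coe_nonneg,
          ENNReal.ofReal_coe_nnreal, ← ENNReal.ofReal_coe_nnreal (p := 1 + β * (V x + V y))]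
        push_cast
        rfl

lemma OscBound.act_iterate (hP : IsMarkovSemigroup P) (hV : IsLyapunov P V C γ K)
    (hd : ∀ x y, d x y ≤ 1) {β ρ t : ℝ≥0}
    (hcontr : ∀ (φ : H → ℝ) (M : ℝ≥0), Measurable φ →
      OscBound d (halfWeight V β) M φ → OscBound d (halfWeight V β) (ρ * M) (act (P t) φ))
    {φ : H → ℝ} {M : ℝ≥0} (hφ : Measurable φ) (h : OscBound d (halfWeight V β) M φ) (k : ℕ) :
    OscBound d (halfWeight V β) (ρ ^ k * M) (act (P (k • t)) φ) := by
  have := hP.markov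
  induction k with
  | zero =>
    intro x y
    simpa [act, hP.zero, Kernel.id_apply, integral_dirac' _ _ hφ.stronglyMeasurable] using h x y
  | succ k ih =>
    have hstep := hcontr _ _ (measurable_act (P (k • t)) hφ) ih
    have heq : act (P ((k + 1) • t)) φ = act (P t) (act (P (k • t)) φ) := by
      funext x
      rw [succ_nsmul']
      exact hP.act_add _ _ (h.integrable hd hφ (halfWeight_ne_top β)
        (lintegral_halfWeight_ne_top hP hV β _ x))
    rw [heq, pow_succ', mul_assoc]
    exact hstep

/-- Invariance cannot be applied to `V` directly, as `∫V dμ` might be infinite on both sides. For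
`min(V, N)`, dominated convergence as time grows gives the bound `K`, uniformly in `N`. -/
lemma IsLyapunov.lintegral_invariant_ne_top (hP : IsMarkovSemigroup P)
    (hV : IsLyapunov P V C γ K) {μ : Measure H} (hμ : IsInvariantMeasure P μ) :
    ∫⁻ x, (V x : ℝ≥0∞) ∂μ ≠ ∞ := by
  have := hμ.prob
  have := hP.markov
  have hVm : Measurable fun x => (V x : ℝ≥0∞) := hV.measurable.coe_nnreal_ennreal
  have htrunc : ∀ N : ℕ, ∫⁻ x, min (V x : ℝ≥0∞) N ∂μ ≤ ENNReal.ofReal K := by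
    intro N
    let F : ℕ → H → ℝ≥0∞ := fun n x =>
      min (ENNReal.ofReal (C * Real.exp (-γ * ((n : ℝ≥0) : ℝ)) * V x + K)) N
    have hF : ∀ n, Measurable (F n) := fun n => by
      have := hV.measurable
      fun_prop
    have hle : ∀ n, ∫⁻ x, min (V x : ℝ≥0∞) N ∂μ ≤ ∫⁻ x, F n x ∂μ := by
      intro n
      calc ∫⁻ x, min (V x : ℝ≥0∞) N ∂μ = ∫⁻ x, min (V x : ℝ≥0∞) N ∂(μ.bind (P n)) := by
            rw [(hμ.invariant n).def]
        _ = ∫⁻ x, ∫⁻ y, min (V y : ℝ≥0∞) N ∂(P n x) ∂μ :=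
            Measure.lintegral_bind (P n).measurable.aemeasurable
              (hVm.min measurable_const).aemeasurable
        _ ≤ ∫⁻ x, F n x ∂μ := by
            refine lintegral_mono fun x => le_min ?_ ?_
            · exact (lintegral_mono fun y => min_le_left _ _).trans (hV.bound n x)
            · exact (lintegral_mono fun y => min_le_right _ _).trans (by simp)
    have hlim : Filter.Tendsto (fun n => ∫⁻ x, F n x ∂μ) Filter.atTop
        (nhds (∫⁻ _, min (ENNReal.ofReal K) N ∂μ)) := by
      refine tendsto_lintegral_of_dominated_convergence (fun _ => (N : ℝ≥0∞)) hF
        (fun n => Filter.Eventually.of_forall fun x => min_le_right _ _) (by simp) ?_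
      refine Filter.Eventually.of_forall fun x => Filter.Tendsto.min ?_ tendsto_const_nhds
      refine ENNReal.tendsto_ofReal ?_
      have hexp : Filter.Tendsto (fun n : ℕ => Real.exp (-γ * ((n : ℝ≥0) : ℝ)))
          Filter.atTop (nhds 0) := by
        refine Real.tendsto_exp_atBot.comp ?_
        simpa using tendsto_natCast_atTop_atTop.const_mul_atTop_of_neg
          (neg_lt_zero.2 hV.γ_pos)
      simpa using ((hexp.const_mul C).mul_const (V x : ℝ)).add_const K
    refine (ge_of_tendsto' hlim hle).trans ?_
    calc ∫⁻ _, min (ENNReal.ofReal K) N ∂μ ≤ ∫⁻ _, ENNReal.ofReal K ∂μ :=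
          lintegral_mono fun _ => min_le_left _ _
      _ = ENNReal.ofReal K := by simp
  have hsup : ∫⁻ x, (V x : ℝ≥0∞) ∂μ = ⨆ N : ℕ, ∫⁻ x, min (V x : ℝ≥0∞) N ∂μ := by
    rw [← lintegral_iSup (fun N => hVm.min measurable_const)
      (fun m n hmn x => min_le_min le_rfl (by exact_mod_cast hmn))]
    refine lintegral_congr fun x => le_antisymm ?_ (iSup_le fun N => min_le_left _ _)
    obtain ⟨N, hN⟩ := exists_nat_ge (V x)
    refine le_iSup_of_le N (le_min le_rfl ?_)
    exact_mod_cast hN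
  rw [hsup]
  exact ((iSup_le htrunc).trans_lt ENNReal.ofReal_lt_top).ne

end Semigroup

/-! ### Comparison with the weighted Lipschitz seminorm. -/

section Seminorm

variable {H : Type*}

lemma lipSeminorm_sub_const (d : H → H → ℝ≥0) (φ : H → ℝ) (c : ℝ) :
    lipSeminorm d (fun x => φ x - c) = lipSeminorm d φ := by
  simp [lipSeminorm]

lemma weighted_sq (d : H → H → ℝ≥0) (V : H → ℝ≥0) (x y : H) :
    weighted d V x y ^ 2 = d x y * (1 + V x + V y) := NNReal.sq_sqrt _

/-- The loss `β⁻¹` comes from `1 + V(x) + V(y) ≤ β⁻¹(1 + β(V(x) + V(y)))`; the way back is free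
because `β ≤ 1`. -/
lemma oscBound_of_lipSeminorm_ne_top [TopologicalSpace H] {d : H → H → ℝ≥0}
    {V : H → ℝ≥0} {φ : H → ℝ}
    (hd : IsSemimetric d) {β : ℝ≥0} (hβ : 0 < β) (hβ1 : β ≤ 1)
    (hφ : lipSeminorm (weighted d V) φ ≠ ∞) :
    OscBound d (halfWeight V β) (β⁻¹ * (lipSeminorm (weighted d V) φ).toNNReal ^ 2) φ := by
  set L := (lipSeminorm (weighted d V) φ).toNNReal with hL
  intro x y
  rcases eq_or_ne x y with rfl | hxy
  · simp
  have hd0 : d x y ≠ 0 := fun h0 => hxy ((hd.eq_zero_iff x y).1 h0)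
  have hw0 : weighted d V x y ≠ 0 := by
    intro h0
    have := weighted_sq d V x y
    rw [h0] at this
    have h1 : (0 : ℝ≥0) < d x y * (1 + V x + V y) := by positivity
    simp [← this] at h1
  have hle : ‖φ x - φ y‖ₑ ≤ L * weighted d V x y := by
    rw [← ENNReal.div_le_iff (by exact_mod_cast hw0) ENNReal.coe_ne_top, hL,
      ENNReal.coe_toNNReal hφ, Real.enorm_eq_ofReal_abs]
    exact le_iSup_of_le x (le_iSup_of_le y (le_iSup_of_le hxy le_rfl))
  have hweights : 1 + V x + V y ≤ β⁻¹ * (1 + β * (V x + V y)) := by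
    rw [mul_add, inv_mul_cancel_left₀ hβ.ne', mul_one, add_assoc]
    gcongr
    exact (one_le_inv₀ hβ).2 hβ1
  calc ‖φ x - φ y‖ₑ ^ 2 ≤ (L * weighted d V x y : ℝ≥0∞) ^ 2 := by gcongr
    _ = ((L ^ 2 * (d x y * (1 + V x + V y)) : ℝ≥0) : ℝ≥0∞) := by
        rw [← weighted_sq]
        push_cast
        ring
    _ ≤ ((L ^ 2 * (d x y * (β⁻¹ * (1 + β * (V x + V y)))) : ℝ≥0) : ℝ≥0∞) := by
        gcongr
    _ = _ := by
        rw [halfWeight_add]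
        norm_cast
        ring

lemma OscBound.lipSeminorm_le {d : H → H → ℝ≥0}
    {V : H → ℝ≥0} {φ : H → ℝ}
    {β r : ℝ≥0} (hβ1 : β ≤ 1) (h : OscBound d (halfWeight V β) (r ^ 2) φ) :
    lipSeminorm (weighted d V) φ ≤ r := by
  refine iSup_le fun x => iSup_le fun y => iSup_le fun _ => ENNReal.div_le_of_le_mul ?_
  rw [← Real.enorm_eq_ofReal_abs]
  refine (ENNReal.pow_le_pow_left_iff two_ne_zero).1 ((h x y).trans ?_)
  rw [halfWeight_add]
  norm_cast
  rw [mul_pow, weighted_sq]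
  rw [add_assoc 1]
  gcongr
  exact mul_le_of_le_one_left' hβ1

end Seminorm

end HarrisGap

theorem corollary3p3 {H : Type*} [NormedAddCommGroup H] [InnerProductSpace ℝ H] [CompleteSpace H]
    [MeasurableSpace H] [BorelSpace H]
    (P : ℝ≥0 → Kernel H H) (hP : HarrisGap.IsMarkovSemigroup P)
    (V : H → ℝ≥0) (hVcont : Continuous V)
    (C γ K : ℝ) (hV : HarrisGap.IsLyapunov P V C γ K)
    (T : ℝ≥0) (hT : 0 < T)
    (d : H → H → ℝ≥0) (hd : HarrisGap.IsSemimetric d) (hd_le_one : ∀ x y, d x y ≤ 1)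
    (hcontr : HarrisGap.IsContracting d (P T))
    (hsmall : HarrisGap.IsSmall d (P T) {x : H | (V x : ℝ) ≤ 4 * K}) :
    ∃ ρ : ℝ≥0, ρ < 1 ∧ ∃ t : ℝ≥0, 0 < t ∧
      ∀ φ : H → ℝ, Measurable φ → HarrisGap.lipSeminorm (HarrisGap.weighted d V) φ < ∞ →
        (∀ x, Integrable φ (P t x)) ∧
        ∀ μ : Measure H, HarrisGap.IsInvariantMeasure P μ →
          Integrable φ μ ∧
          HarrisGap.lipSeminorm (HarrisGap.weighted d V)
              (fun x => HarrisGap.act (P t) φ x - ∫ y, φ y ∂μ) ≤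
            (ρ : ℝ≥0∞) * HarrisGap.lipSeminorm (HarrisGap.weighted d V)
              (fun x => φ x - ∫ y, φ y ∂μ) := by
  obtain ⟨β, ρ, t, hβ, hβ1, hρ, ht, hstep⟩ :=
    HarrisGap.exists_oscBound_contraction hP hV hd_le_one hT hcontr hsmall
  have := hP.markov
  -- Enough iterations beat the loss `β⁻¹`; using `k + 1` of them makes the time visibly positive.
  -- The rate is a square root because oscillation bounds are quadratic.
  obtain ⟨k, hk⟩ := NNReal.exists_pow_lt_of_lt_one hβ hρ
  have hk1 : ρ ^ (k + 1) * β⁻¹ < 1 := by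
    rw [← div_eq_mul_inv, div_lt_one hβ]
    exact (pow_le_pow_of_le_one zero_le hρ.le k.le_succ).trans_lt hk
  refine ⟨NNReal.sqrt (ρ ^ (k + 1) * β⁻¹), ?_, (k + 1) • t, by positivity, ?_⟩
  · rwa [← NNReal.sqrt_one, NNReal.sqrt_lt_sqrt]
  intro φ hφ hL
  have hosc := HarrisGap.oscBound_of_lipSeminorm_ne_top hd hβ hβ1 hL.ne
  have hiter := hosc.act_iterate hP hV hd_le_one hstep hφ (k + 1)
  refine ⟨fun x => hosc.integrable hd_le_one hφ (HarrisGap.halfWeight_ne_top β)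
    (HarrisGap.lintegral_halfWeight_ne_top hP hV β _ x), fun μ hμ => ?_⟩
  have := hμ.prob
  refine ⟨hosc.integrable hd_le_one hφ (HarrisGap.halfWeight_ne_top β) ?_, ?_⟩
  · rw [HarrisGap.lintegral_halfWeight]
    exact ENNReal.add_ne_top.2 ⟨by simp, ENNReal.mul_ne_top ENNReal.coe_ne_top
      (hV.lintegral_invariant_ne_top hP hμ)⟩
  · rw [HarrisGap.lipSeminorm_sub_const, HarrisGap.lipSeminorm_sub_const]
    rw [← ENNReal.coe_toNNReal hL.ne, ← ENNReal.coe_mul]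
    refine HarrisGap.OscBound.lipSeminorm_le hβ1 ?_
    rwa [mul_pow, NNReal.sq_sqrt, mul_assoc]
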